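/- **Theorem (Hu–Zhang).** Let $n\ge 0$ and let $S_n$ be the symmetric group on $\{1,\dots,n\}$, with simple generators $s_i=(i,i+1)$ for $1\le i\le n-1$ and Coxeter length $\ell(w)$, the least number of simple generators with product $w$. For $w\in S_n$ put $s_i\circ w=s_iw$ if $\ell(w)<\ell(s_iw)$ and $s_i\circ w=w$ otherwise; $w\circ s_i=ws_i$ if $\ell(w)<\ell(ws_i)$ and $w\circ s_i=w$ otherwise; and $w\triangleleft s_i=(s_i\circ w)\circ s_i$. For $x\in S_n$ with $x=x^{-1}$, let $\hat{\mathcal R}(x)$ be the set of involution words of $x$, that is, of the sequences $(t_1,\dots,t_k)$ of simple generators of shortest possible length $k$ such that $$(\cdots((1\triangleleft t_1)\triangleleft t_2)\cdots)\triangleleft t_k=x.$$ Then for every $x\in S_n$ with $x=x^{-1}$, the set $\hat{\mathcal R}(x)$ is (exactly) one equivalence class, in the set of all finite sequences of simple generators, under the equivalence relation generated by the braid relations $$(\dots,s_i,s_{i+1},s_i,\dots)\sim(\dots,s_{i+1},s_i,s_{i+1},\dots)\quad(1\le i\le n-2),$$ $$(\dots,s_i,s_j,\dots)\sim(\dots,s_j,s_i,\dots)\quad(1\le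 i,j\le n-1,\ |i-j|>1),$$ applied at any position of a sequence, together with the relations $$(s_i,s_{i+1},\dots)\sim(s_{i+1},s_i,\dots)\quad(1\le i\le n-2),$$ applied to the first two entries only. (Entries shown as dots are arbitrary and agree on the two sides.) -/

import Mathlib

namespace InvWords

/-- The simple transposition `s_i = (i, i+1)` of `S_n = Equiv.Perm (Fin n)`. The `n - 1` simple
generators are indexed by `Fin (n - 1)`, and the points permuted are `0, …, n - 1`. -/
def simpleRefl {n : ℕ} (i : Fin (n - 1)) : Equiv.Perm (Fin n) :=
  Equiv.swap ⟨i.val, by omega⟩ ⟨i.val + 1, by omega⟩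

/-- A finite sequence `(s_{i_1}, …, s_{i_k})` of simple generators, recorded by its indices. -/
abbrev Word (n : ℕ) : Type := List (Fin (n - 1))

/-- The (ordinary) product `s_{i_1} ⋯ s_{i_k}`. -/
def wordProd {n : ℕ} (a : Word n) : Equiv.Perm (Fin n) :=
  (a.map simpleRefl).prod

/-- The simple transpositions generate `S_n`, so that the length below is a true minimum. -/
theorem exists_wordProd_eq {n : ℕ} (w : Equiv.Perm (Fin n)) : ∃ a : Word n, wordProd a = w := by
  rcases n with _ | m
  · exact ⟨[], Subsingleton.elim _ _⟩
  · have hw : w ∈ Submonoid.closure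
        (Set.range fun i : Fin m => Equiv.swap i.castSucc i.succ) := by
      rw [Equiv.Perm.mclosure_swap_castSucc_succ]
      trivial
    induction hw using Submonoid.closure_induction with
    | mem x hx =>
      obtain ⟨i, rfl⟩ := hx
      exact ⟨[i], by simp [wordProd, simpleRefl, Fin.castSucc, Fin.succ]; rfl⟩
    | one => exact ⟨[], rfl⟩
    | mul x y _ _ hx hy =>
      obtain ⟨a, rfl⟩ := hx
      obtain ⟨b, rfl⟩ := hy
      exact ⟨a ++ b, by simp [wordProd]⟩

/-- The Coxeter length `ℓ(w)`: the least number of simple generators with product `w`. -/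
noncomputable def len {n : ℕ} (w : Equiv.Perm (Fin n)) : ℕ :=
  sInf {k : ℕ | ∃ a : Word n, a.length = k ∧ wordProd a = w}

/-- The Demazure product `s_i ∘ w`. -/
noncomputable def demLeft {n : ℕ} (i : Fin (n - 1)) (w : Equiv.Perm (Fin n)) :
    Equiv.Perm (Fin n) :=
  if len w < len (simpleRefl i * w) then simpleRefl i * w else w

/-- The Demazure product `w ∘ s_i`. -/
noncomputable def demRight {n : ℕ} (w : Equiv.Perm (Fin n)) (i : Fin (n - 1)) :
    Equiv.Perm (Fin n) :=
  if len w < len (w * simpleRefl i) then w * simpleRefl i else w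

/-- The operation `x ↦ (s_i)⁻¹ ∘ x ∘ s_i = s_i ∘ x ∘ s_i`, taken with trivial diagram
automorphism. -/
noncomputable def act {n : ℕ} (x : Equiv.Perm (Fin n)) (i : Fin (n - 1)) : Equiv.Perm (Fin n) :=
  demRight (demLeft i x) i

/-- Act successively by the letters of a word, first letter first. -/
noncomputable def actWord {n : ℕ} (x : Equiv.Perm (Fin n)) (a : Word n) : Equiv.Perm (Fin n) :=
  a.foldl act x

/-- The set of involution words of `y` relative to `x`: the words of shortest possible length
that carry `x` to `y`. -/
def relInvolutionWords {n : ℕ} (x y : Equiv.Perm (Fin n)) : Set (Word n) :=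
  {a | actWord x a = y ∧ ∀ b : Word n, actWord x b = y → a.length ≤ b.length}

/-- The set of involution words of `y`, relative to the identity. -/
def involutionWords {n : ℕ} (y : Equiv.Perm (Fin n)) : Set (Word n) :=
  relInvolutionWords 1 y

/-- The braid relations of `S_n`, which may be applied anywhere in a word. -/
inductive BraidRel {n : ℕ} : Word n → Word n → Prop
  | braid (a b : Word n) (i j : Fin (n - 1)) (h : i.val + 1 = j.val) :
      BraidRel (a ++ [i, j, i] ++ b) (a ++ [j, i, j] ++ b)
  | comm (a b : Word n) (i j : Fin (n - 1)) (h : i.val + 1 < j.val ∨ j.val + 1 < i.val) :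
      BraidRel (a ++ [i, j] ++ b) (a ++ [j, i] ++ b)

/-- The relations `(s_i, s_{i+1}, …) ∼ (s_{i+1}, s_i, …)`, which apply only to the first two
letters of a word. -/
inductive InitialRel {n : ℕ} : Word n → Word n → Prop
  | swap (b : Word n) (i j : Fin (n - 1)) (h : i.val + 1 = j.val) :
      InitialRel (i :: j :: b) (j :: i :: b)

/-- The equivalence relation on all words generated by the braid relations together with the
initial relations. -/
def involutionBraidSetoid (n : ℕ) : Setoid (Word n) :=
  Relation.EqvGen.setoid fun a b => BraidRel a b ∨ InitialRel a b

end InvWords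

/-! The Coxeter length counts inversions, so a Demazure product by `s_i` is governed by one
comparison of adjacent values. On an involution `x`, `act x i` is `x` at a descent. At an ascent it
is `x * s_i` if both moved points are fixed, and the conjugate `s_i * x * s_i` otherwise. At an
ascent, twice the number of inversions plus the size of the support (`rank`) always grows by 4.
Hence involution words are the words from 1 to `x` of length `rank x / 4`, and their last letters
are the descents of `x`.

The relations preserve the length of a word and its action on 1: `act` inherits the braid relations
from the two commuting Demazure products, and the initial relation is a computation at 1
(`Equivalent.actWord_one_eq`).

Conversely, induct on the rank (`equivalent_of_isReduced`). Words with the same last letter are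
settled by deleting it. For distinct last letters `i < j` it suffices to exhibit one pair of
equivalent words with these endings. A commutation or braid relation at the end of a word provides
it unless `x (lo i) = hi j`. In that case a third descent, if one serves, is linked to both `i` and
`j`. Otherwise the generators commute and the obstruction is incomplete, or `x` is the reversal of
three consecutive points, where the initial relation applies (`linked_or_exists`). -/

namespace InvWords

open Equiv

variable {n : ℕ}

/-! ### Simple transpositions. -/

/-- The left point moved by `s_i`. -/
def lo (i : Fin (n - 1)) : Fin n := ⟨i.val, by omega⟩

/-- The right point moved by `s_i`. -/
def hi (i : Fin (n - 1)) : Fin n := ⟨i.val + 1, by omega⟩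

theorem simpleRefl_eq (i : Fin (n - 1)) : simpleRefl i = swap (lo i) (hi i) := rfl

@[simp] theorem lo_val (i : Fin (n - 1)) : (lo i).val = i.val := rfl

@[simp] theorem hi_val (i : Fin (n - 1)) : (hi i).val = i.val + 1 := rfl

theorem lo_lt_hi (i : Fin (n - 1)) : lo i < hi i := by simp [Fin.lt_def]

theorem lo_ne_hi (i : Fin (n - 1)) : lo i ≠ hi i := (lo_lt_hi i).ne

@[simp] theorem simpleRefl_lo (i : Fin (n - 1)) : simpleRefl i (lo i) = hi i :=
  swap_apply_left _ _

@[simp] theorem simpleRefl_hi (i : Fin (n - 1)) : simpleRefl i (hi i) = lo i :=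
  swap_apply_right _ _

theorem simpleRefl_of_ne {i : Fin (n - 1)} {p : Fin n} (h₁ : p ≠ lo i) (h₂ : p ≠ hi i) :
    simpleRefl i p = p :=
  swap_apply_of_ne_of_ne h₁ h₂

@[simp] theorem simpleRefl_simpleRefl (i : Fin (n - 1)) (p : Fin n) :
    simpleRefl i (simpleRefl i p) = p :=
  swap_apply_self _ _ _

@[simp] theorem simpleRefl_mul_self (i : Fin (n - 1)) : simpleRefl i * simpleRefl i = 1 :=
  swap_mul_self _ _

@[simp] theorem simpleRefl_inv (i : Fin (n - 1)) : (simpleRefl i)⁻¹ = simpleRefl i :=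
  swap_inv _ _

theorem simpleRefl_lt {i : Fin (n - 1)} {p q : Fin n} (h : p < q)
    (h' : ¬(p = lo i ∧ q = hi i)) : simpleRefl i p < simpleRefl i q := by
  simp only [simpleRefl_eq, swap_apply_def]
  split_ifs <;> simp only [Fin.lt_def, Fin.ext_iff, lo_val, hi_val] at * <;> omega

/-! ### Inversions and Coxeter length. -/

/-- The inversions of a permutation. -/
def inversions (w : Perm (Fin n)) : Finset (Fin n × Fin n) :=
  Finset.univ.filter fun p => p.1 < p.2 ∧ w p.2 < w p.1

theorem mem_inversions {w : Perm (Fin n)} {p q : Fin n} :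
    (p, q) ∈ inversions w ↔ p < q ∧ w q < w p := by
  simp [inversions]

/-- Applying `s_i` to both positions preserves the order of every pair except `(lo i, hi i)`, which
becomes the one new inversion. -/
theorem inversions_mul_simpleRefl {w : Perm (Fin n)} {i : Fin (n - 1)} (h : w (lo i) < w (hi i)) :
    inversions (w * simpleRefl i) = insert (lo i, hi i)
      ((inversions w).map (Equiv.prodCongr (simpleRefl i) (simpleRefl i)).toEmbedding) := by
  ext ⟨p, q⟩
  have e : (Equiv.prodCongr (simpleRefl i) (simpleRefl i)).symm (p, q) =
      (simpleRefl i p, simpleRefl i q) := rfl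
  rw [Finset.mem_insert, Finset.mem_map_equiv, e, mem_inversions, mem_inversions, Prod.mk.injEq,
    Perm.mul_apply, Perm.mul_apply]
  constructor
  · rintro ⟨h₁, h₂⟩
    by_cases h₃ : p = lo i ∧ q = hi i
    · exact Or.inl h₃
    · exact Or.inr ⟨simpleRefl_lt h₁ h₃, h₂⟩
  · rintro (⟨rfl, rfl⟩ | ⟨h₁, h₂⟩)
    · simpa [lo_lt_hi] using h
    · refine ⟨?_, h₂⟩
      have := simpleRefl_lt (i := i) h₁ fun h₃ => by
        rw [h₃.1, h₃.2] at h₂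
        exact lt_asymm h h₂
      simpa using this

theorem card_inversions_mul_simpleRefl {w : Perm (Fin n)} {i : Fin (n - 1)}
    (h : w (lo i) < w (hi i)) :
    (inversions (w * simpleRefl i)).card = (inversions w).card + 1 := by
  rw [inversions_mul_simpleRefl h, Finset.card_insert_of_notMem, Finset.card_map]
  rw [Finset.mem_map_equiv]
  have e : (Equiv.prodCongr (simpleRefl i) (simpleRefl i)).symm (lo i, hi i) =
      (simpleRefl i (lo i), simpleRefl i (hi i)) := rfl
  rw [e, mem_inversions, simpleRefl_lo, simpleRefl_hi]
  exact fun h' => lt_asymm h'.1 (lo_lt_hi i)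

theorem apply_lo_ne_apply_hi (w : Perm (Fin n)) (i : Fin (n - 1)) : w (lo i) ≠ w (hi i) :=
  fun h => lo_ne_hi i (w.injective h)

theorem card_inversions_mul_simpleRefl_of_gt {w : Perm (Fin n)} {i : Fin (n - 1)}
    (h : w (hi i) < w (lo i)) :
    (inversions (w * simpleRefl i)).card + 1 = (inversions w).card := by
  have := card_inversions_mul_simpleRefl (w := w * simpleRefl i) (i := i) (by simpa using h)
  rw [← this, mul_assoc, simpleRefl_mul_self, mul_one]

theorem inversions_one : inversions (1 : Perm (Fin n)) = ∅ := by
  ext ⟨p, q⟩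
  simp only [mem_inversions, Perm.one_apply, Finset.notMem_empty, iff_false]
  exact fun h => lt_asymm h.1 h.2

theorem card_inversions_inv (w : Perm (Fin n)) :
    (inversions w⁻¹).card = (inversions w).card := by
  refine Finset.card_bij (fun p _ => (w⁻¹ p.2, w⁻¹ p.1)) ?_ ?_ ?_
  · rintro ⟨p, q⟩ h
    rw [mem_inversions] at h
    simpa [mem_inversions] using h.symm
  · rintro ⟨p, q⟩ _ ⟨p', q'⟩ _ h
    simpa [and_comm] using h
  · rintro ⟨p, q⟩ h
    rw [mem_inversions] at h
    exact ⟨(w q, w p), by simpa [mem_inversions] using h.symm, by simp⟩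

/-- A permutation without descents is the identity. -/
theorem eq_one_of_forall_lt {w : Perm (Fin n)} (h : ∀ i, w (lo i) < w (hi i)) : w = 1 := by
  have hm : StrictMono w := by
    rcases n with _ | m
    · exact fun a => a.elim0
    · exact Fin.strictMono_iff_lt_succ.2 fun i => h i
  have := Subsingleton.elim (hm.orderIsoOfSurjective w w.surjective) (OrderIso.refl _)
  ext p
  exact congrArg (fun e : Fin n ≃o Fin n => (e p).val) this

theorem exists_gt_of_ne_one {w : Perm (Fin n)} (h : w ≠ 1) : ∃ i, w (hi i) < w (lo i) := by
  by_contra! h'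
  exact h (eq_one_of_forall_lt fun i => lt_of_le_of_ne (h' i) (apply_lo_ne_apply_hi w i))

theorem card_inversions_wordProd_le (a : Word n) :
    (inversions (wordProd a)).card ≤ a.length := by
  induction a using List.reverseRecOn with
  | nil => simp [wordProd, inversions_one]
  | append_singleton a i ih =>
    have e : wordProd (a ++ [i]) = wordProd a * simpleRefl i := by simp [wordProd]
    rw [e, List.length_append, List.length_singleton]
    rcases lt_or_gt_of_ne (apply_lo_ne_apply_hi (wordProd a) i) with h | h
    · rw [card_inversions_mul_simpleRefl h]
      omega
    · have := card_inversions_mul_simpleRefl_of_gt h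
      omega

theorem exists_wordProd_length_eq (w : Perm (Fin n)) :
    ∃ a : Word n, a.length = (inversions w).card ∧ wordProd a = w := by
  induction hk : (inversions w).card generalizing w with
  | zero =>
    refine ⟨[], rfl, ?_⟩
    by_contra h
    obtain ⟨i, hi'⟩ := exists_gt_of_ne_one (Ne.symm h)
    have := card_inversions_mul_simpleRefl_of_gt hi'
    omega
  | succ k ih =>
    have h : w ≠ 1 := by
      rintro rfl
      simp [inversions_one] at hk
    obtain ⟨i, h'⟩ := exists_gt_of_ne_one h
    obtain ⟨a, ha, ha'⟩ := ih (w * simpleRefl i) (by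
      have := card_inversions_mul_simpleRefl_of_gt h'
      omega)
    refine ⟨a ++ [i], by simp [ha], ?_⟩
    have e : wordProd (a ++ [i]) = wordProd a * simpleRefl i := by simp [wordProd]
    rw [e, ha', mul_assoc, simpleRefl_mul_self, mul_one]

/-- The Coxeter length is the number of inversions. -/
theorem len_eq_card_inversions (w : Perm (Fin n)) : len w = (inversions w).card := by
  apply le_antisymm
  · exact Nat.sInf_le (exists_wordProd_length_eq w)
  · obtain ⟨a, ha⟩ := exists_wordProd_eq w
    refine le_csInf ⟨_, a, rfl, ha⟩ ?_
    rintro _ ⟨b, rfl, rfl⟩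
    exact card_inversions_wordProd_le b

theorem len_lt_mul_iff (w : Perm (Fin n)) (i : Fin (n - 1)) :
    len w < len (w * simpleRefl i) ↔ w (lo i) < w (hi i) := by
  rw [len_eq_card_inversions, len_eq_card_inversions]
  rcases lt_or_gt_of_ne (apply_lo_ne_apply_hi w i) with h | h
  · rw [card_inversions_mul_simpleRefl h]
    simpa using h
  · have := card_inversions_mul_simpleRefl_of_gt h
    exact ⟨fun _ => by omega, fun h' => (lt_asymm h h').elim⟩

theorem len_inv (w : Perm (Fin n)) : len w⁻¹ = len w := by
  rw [len_eq_card_inversions, len_eq_card_inversions, card_inversions_inv]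

/-! ### Demazure products: ascent tests, commutation and braid relations. -/

theorem demRight_eq (w : Perm (Fin n)) (i : Fin (n - 1)) :
    demRight w i = if w (lo i) < w (hi i) then w * simpleRefl i else w := by
  simp only [demRight, len_lt_mul_iff]

/-- Inversion exchanges the two sides, so facts about left products follow from those about right
products. -/
theorem demRight_inv (w : Perm (Fin n)) (i : Fin (n - 1)) :
    (demRight w⁻¹ i)⁻¹ = demLeft i w := by
  have h : len (simpleRefl i * w) = len (w⁻¹ * simpleRefl i) := by
    rw [← len_inv, mul_inv_rev, simpleRefl_inv]
  unfold demRight demLeft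
  rw [h, len_inv]
  split_ifs <;> simp

theorem demLeft_eq (w : Perm (Fin n)) (i : Fin (n - 1)) :
    demLeft i w = if w⁻¹ (lo i) < w⁻¹ (hi i) then simpleRefl i * w else w := by
  rw [← demRight_inv, demRight_eq]
  split_ifs <;> simp

theorem simpleRefl_lt_iff {i : Fin (n - 1)} {p q : Fin n}
    (h : ¬(p = lo i ∧ q = hi i)) (h' : ¬(q = lo i ∧ p = hi i)) :
    simpleRefl i p < simpleRefl i q ↔ p < q := by
  constructor
  · intro h₁
    by_contra h₂
    rcases lt_or_eq_of_le (not_lt.1 h₂) with h₃ | rfl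
    · exact lt_asymm h₁ (simpleRefl_lt h₃ h')
    · exact lt_irrefl _ h₁
  · exact fun h₁ => simpleRefl_lt h₁ h

/-- The left and right Demazure products commute. -/
theorem demLeft_demRight (w : Perm (Fin n)) (i j : Fin (n - 1)) :
    demLeft i (demRight w j) = demRight (demLeft i w) j := by
  by_cases h₁ : w (lo j) = lo i ∧ w (hi j) = hi i
  · have e : simpleRefl i * w = w * simpleRefl j := by
      rw [simpleRefl_eq, simpleRefl_eq, mul_swap_eq_swap_mul, h₁.1, h₁.2]
    have e₁ : w⁻¹ (lo i) = lo j := by rw [← h₁.1]; simp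
    have e₂ : w⁻¹ (hi i) = hi j := by rw [← h₁.2]; simp
    simp [demLeft_eq, demRight_eq, e₁, e₂, h₁.1, h₁.2, lo_lt_hi, e, (lo_lt_hi _).not_gt, -Perm.coe_inv]
  · by_cases h₂ : w (lo j) = hi i ∧ w (hi j) = lo i
    · have e₁ : w⁻¹ (hi i) = lo j := by rw [← h₂.1]; simp
      have e₂ : w⁻¹ (lo i) = hi j := by rw [← h₂.2]; simp
      simp [demLeft_eq, demRight_eq, e₁, e₂, h₂.1, h₂.2, (lo_lt_hi _).not_gt, -Perm.coe_inv]
    · have e₁ : simpleRefl i (w (lo j)) < simpleRefl i (w (hi j)) ↔ w (lo j) < w (hi j) :=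
        simpleRefl_lt_iff h₁ fun h => h₂ h.symm
      have e₂ : simpleRefl j (w⁻¹ (lo i)) < simpleRefl j (w⁻¹ (hi i)) ↔
          w⁻¹ (lo i) < w⁻¹ (hi i) := by
        apply simpleRefl_lt_iff
        · rintro ⟨h, h'⟩
          exact h₁ ⟨by rw [← h]; simp, by rw [← h']; simp⟩
        · rintro ⟨h, h'⟩
          exact h₂ ⟨by rw [← h]; simp, by rw [← h']; simp⟩
      rw [demRight_eq w, demLeft_eq w]
      split_ifs with h h' h' <;>
        simp [demLeft_eq, demRight_eq, e₁, e₂, h, h', mul_assoc, -Perm.coe_inv]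

theorem lo_eq_hi {i j : Fin (n - 1)} (h : i.val + 1 = j.val) : lo j = hi i :=
  Fin.ext h.symm

theorem simpleRefl_braid {i j : Fin (n - 1)} (h : i.val + 1 = j.val) :
    simpleRefl i * simpleRefl j * simpleRefl i = simpleRefl j * simpleRefl i * simpleRefl j := by
  have h₁ : lo i ≠ hi j := by simp only [ne_eq, Fin.ext_iff, lo_val, hi_val]; omega
  have h₂ : hi i ≠ hi j := by rw [← lo_eq_hi h]; exact lo_ne_hi j
  have e₁ := swap_mul_swap_mul_swap h₂.symm h₁.symm
  have e₂ := swap_mul_swap_mul_swap (lo_ne_hi i) h₁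
  rw [simpleRefl_eq, simpleRefl_eq, lo_eq_hi h, e₂, swap_comm (lo i), swap_comm (hi i) (hi j), e₁,
    swap_comm]

theorem simpleRefl_comm {i j : Fin (n - 1)} (h : i.val + 1 < j.val ∨ j.val + 1 < i.val) :
    simpleRefl i * simpleRefl j = simpleRefl j * simpleRefl i := by
  rw [simpleRefl_eq i, mul_swap_eq_swap_mul, simpleRefl_of_ne, simpleRefl_of_ne] <;>
    simp only [ne_eq, Fin.ext_iff, lo_val, hi_val] <;> omega

theorem demRight_comm {i j : Fin (n - 1)} (h : i.val + 1 < j.val ∨ j.val + 1 < i.val)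
    (w : Perm (Fin n)) : demRight (demRight w i) j = demRight (demRight w j) i := by
  have e₁ : simpleRefl i (lo j) = lo j := by
    apply simpleRefl_of_ne <;> simp only [ne_eq, Fin.ext_iff, lo_val, hi_val] <;> omega
  have e₂ : simpleRefl i (hi j) = hi j := by
    apply simpleRefl_of_ne <;> simp only [ne_eq, Fin.ext_iff, lo_val, hi_val] <;> omega
  have e₃ : simpleRefl j (lo i) = lo i := by
    apply simpleRefl_of_ne <;> simp only [ne_eq, Fin.ext_iff, lo_val, hi_val] <;> omega
  have e₄ : simpleRefl j (hi i) = hi i := by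
    apply simpleRefl_of_ne <;> simp only [ne_eq, Fin.ext_iff, lo_val, hi_val] <;> omega
  rw [demRight_eq w i, demRight_eq w j]
  split_ifs with h₁ h₂ h₂ <;>
    simp [demRight_eq, e₁, e₂, e₃, e₄, h₁, h₂, mul_assoc, simpleRefl_comm h]

/-- Each product puts two adjacent values in decreasing order, so both sides sort the three values
at `lo i`, `hi i`, `hi j` decreasingly. -/
theorem demRight_braid {i j : Fin (n - 1)} (h : i.val + 1 = j.val) (w : Perm (Fin n)) :
    demRight (demRight (demRight w i) j) i = demRight (demRight (demRight w j) i) j := by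
  have e₁ : simpleRefl i (hi j) = hi j := by
    apply simpleRefl_of_ne <;> simp only [ne_eq, Fin.ext_iff, lo_val, hi_val] <;> omega
  have e₂ : simpleRefl j (lo i) = lo i := by
    apply simpleRefl_of_ne <;> simp only [ne_eq, Fin.ext_iff, lo_val, hi_val] <;> omega
  have e₃ : simpleRefl j (hi i) = hi j := by rw [← lo_eq_hi h, simpleRefl_lo]
  have e₄ : simpleRefl j (hi j) = hi i := by rw [← lo_eq_hi h, simpleRefl_hi]
  have b := simpleRefl_braid h
  rw [mul_assoc, mul_assoc] at b
  have n₁ := apply_lo_ne_apply_hi w i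
  have n₂ := apply_lo_ne_apply_hi w j
  have n₃ : w (lo i) ≠ w (hi j) := fun h' => by
    have := congrArg Fin.val (w.injective h')
    simp only [lo_val, hi_val] at this
    omega
  rw [lo_eq_hi h] at n₂
  -- Of the eight sign patterns, two contradict transitivity; the other six are the orderings of
  -- three values.
  rcases lt_or_gt_of_ne n₁ with h₁ | h₁ <;> rcases lt_or_gt_of_ne n₂ with h₂ | h₂ <;>
    rcases lt_or_gt_of_ne n₃ with h₃ | h₃ <;>
    first
    | exact absurd (h₁.trans h₂) h₃.not_gt
    | exact absurd (h₂.trans h₁) h₃.not_gt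
    | simp [demRight_eq, lo_eq_hi h, e₁, e₂, e₃, e₄, h₁, h₂, h₃, h₁.not_gt, h₂.not_gt, h₃.not_gt,
        mul_assoc, b]

theorem demLeft_comm {i j : Fin (n - 1)} (h : i.val + 1 < j.val ∨ j.val + 1 < i.val)
    (w : Perm (Fin n)) : demLeft j (demLeft i w) = demLeft i (demLeft j w) := by
  simp only [← demRight_inv, inv_inv, demRight_comm h]

theorem demLeft_braid {i j : Fin (n - 1)} (h : i.val + 1 = j.val) (w : Perm (Fin n)) :
    demLeft i (demLeft j (demLeft i w)) = demLeft j (demLeft i (demLeft j w)) := by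
  simp only [← demRight_inv, inv_inv, demRight_braid h]

theorem act_comm {i j : Fin (n - 1)} (h : i.val + 1 < j.val ∨ j.val + 1 < i.val)
    (w : Perm (Fin n)) : act (act w i) j = act (act w j) i := by
  simp only [act, demLeft_demRight, demRight_comm h, demLeft_comm h]

theorem act_braid {i j : Fin (n - 1)} (h : i.val + 1 = j.val) (w : Perm (Fin n)) :
    act (act (act w i) j) i = act (act (act w j) i) j := by
  simp only [act, demLeft_demRight, demRight_braid h, demLeft_braid h]

/-! ### The action on involutions and its inverse at a descent. -/

theorem apply_apply_of_inv_eq {x : Perm (Fin n)} (hx : x⁻¹ = x) (p : Fin n) : x (x p) = p := by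
  have : x⁻¹ (x p) = p := x.symm_apply_apply p
  rwa [hx] at this

theorem apply_eq_iff_of_inv_eq {x : Perm (Fin n)} (hx : x⁻¹ = x) {p q : Fin n} :
    x p = q ↔ x q = p := by
  constructor <;> rintro rfl <;> exact apply_apply_of_inv_eq hx _

theorem act_of_gt {x : Perm (Fin n)} (hx : x⁻¹ = x) {i : Fin (n - 1)} (h : x (hi i) < x (lo i)) :
    act x i = x := by
  rw [act, demLeft_eq, hx, if_neg h.not_gt, demRight_eq, if_neg h.not_gt]

theorem act_of_fixed {x : Perm (Fin n)} (hx : x⁻¹ = x) {i : Fin (n - 1)} (h₁ : x (lo i) = lo i)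
    (h₂ : x (hi i) = hi i) : act x i = x * simpleRefl i := by
  have e : simpleRefl i * x = x * simpleRefl i := by
    rw [simpleRefl_eq, mul_swap_eq_swap_mul, h₁, h₂]
  rw [act, demLeft_eq, hx, h₁, h₂, if_pos (lo_lt_hi i), demRight_eq, Perm.mul_apply,
    Perm.mul_apply, h₁, h₂, simpleRefl_lo, simpleRefl_hi, if_neg (lo_lt_hi i).not_gt, e]

theorem act_of_lt {x : Perm (Fin n)} (hx : x⁻¹ = x) {i : Fin (n - 1)} (h : x (lo i) < x (hi i))
    (h' : x (lo i) ≠ lo i ∨ x (hi i) ≠ hi i) :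
    act x i = simpleRefl i * x * simpleRefl i := by
  rw [act, demLeft_eq, hx, if_pos h, demRight_eq, Perm.mul_apply, Perm.mul_apply,
    if_pos (simpleRefl_lt h (by tauto))]

/-- The involution `y` with ascent `i` such that `act y i = x`, for an involution `x` with
descent `i`. -/
def down (x : Perm (Fin n)) (i : Fin (n - 1)) : Perm (Fin n) :=
  if x (lo i) = hi i then x * simpleRefl i else simpleRefl i * x * simpleRefl i

theorem mul_simpleRefl_inv {x : Perm (Fin n)} (hx : x⁻¹ = x) {i : Fin (n - 1)}
    (h : simpleRefl i * x = x * simpleRefl i) : (x * simpleRefl i)⁻¹ = x * simpleRefl i := by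
  rw [mul_inv_rev, simpleRefl_inv, hx, h]

theorem conj_simpleRefl_inv {x : Perm (Fin n)} (hx : x⁻¹ = x) (i : Fin (n - 1)) :
    (simpleRefl i * x * simpleRefl i)⁻¹ = simpleRefl i * x * simpleRefl i := by
  rw [mul_inv_rev, mul_inv_rev, simpleRefl_inv, hx, mul_assoc]

theorem simpleRefl_mul_of_swapped {x : Perm (Fin n)} (hx : x⁻¹ = x) {i : Fin (n - 1)}
    (h : x (lo i) = hi i) : simpleRefl i * x = x * simpleRefl i := by
  rw [simpleRefl_eq, mul_swap_eq_swap_mul, h, (apply_eq_iff_of_inv_eq hx).1 h, swap_comm]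

theorem simpleRefl_mul_of_fixed {x : Perm (Fin n)} {i : Fin (n - 1)} (h₁ : x (lo i) = lo i)
    (h₂ : x (hi i) = hi i) : simpleRefl i * x = x * simpleRefl i := by
  rw [simpleRefl_eq, mul_swap_eq_swap_mul, h₁, h₂]

theorem down_inv {x : Perm (Fin n)} (hx : x⁻¹ = x) (i : Fin (n - 1)) : (down x i)⁻¹ = down x i := by
  unfold down
  split_ifs with h
  · exact mul_simpleRefl_inv hx (simpleRefl_mul_of_swapped hx h)
  · exact conj_simpleRefl_inv hx i

theorem act_inv {x : Perm (Fin n)} (hx : x⁻¹ = x) (i : Fin (n - 1)) : (act x i)⁻¹ = act x i := by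
  rcases lt_or_gt_of_ne (apply_lo_ne_apply_hi x i) with h | h
  · by_cases h' : x (lo i) = lo i ∧ x (hi i) = hi i
    · rw [act_of_fixed hx h'.1 h'.2]
      exact mul_simpleRefl_inv hx (simpleRefl_mul_of_fixed h'.1 h'.2)
    · rw [act_of_lt hx h (by tauto)]
      exact conj_simpleRefl_inv hx i
  · rwa [act_of_gt hx h]

theorem down_lt {x : Perm (Fin n)} {i : Fin (n - 1)} (h : x (hi i) < x (lo i)) :
    down x i (lo i) < down x i (hi i) := by
  unfold down
  split_ifs with h'
  · simpa using h
  · simp only [Perm.mul_apply, simpleRefl_lo, simpleRefl_hi]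
    refine simpleRefl_lt h fun h'' => ?_
    exact h' h''.2

theorem act_down {x : Perm (Fin n)} (hx : x⁻¹ = x) {i : Fin (n - 1)} (h : x (hi i) < x (lo i)) :
    act (down x i) i = x := by
  have hl := down_lt h
  have hi' := down_inv hx i
  unfold down at *
  split_ifs at * with h'
  · have h'' := (apply_eq_iff_of_inv_eq hx).1 h'
    rw [act_of_fixed hi' (by simp [h'']) (by simp [h']), mul_assoc, simpleRefl_mul_self, mul_one]
  · rw [act_of_lt hi' hl]
    · simp only [mul_assoc, simpleRefl_mul_self, mul_one]
      rw [← mul_assoc, simpleRefl_mul_self, one_mul]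
    -- If the conjugate fixed both points, so would `x`, against the descent.
    · by_contra! h''
      have e := h''.2
      simp only [Perm.mul_apply, simpleRefl_hi] at e
      have := congrArg (simpleRefl i) e
      rw [simpleRefl_simpleRefl, simpleRefl_hi] at this
      have e := h''.1
      simp only [Perm.mul_apply, simpleRefl_lo] at e
      have e' := congrArg (simpleRefl i) e
      rw [simpleRefl_simpleRefl, simpleRefl_lo] at e'
      rw [this, e'] at h
      exact lt_asymm h (lo_lt_hi i)

theorem act_gt {x : Perm (Fin n)} (hx : x⁻¹ = x) (i : Fin (n - 1)) :
    act x i (hi i) < act x i (lo i) := by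
  rcases lt_or_gt_of_ne (apply_lo_ne_apply_hi x i) with h | h
  · by_cases h' : x (lo i) = lo i ∧ x (hi i) = hi i
    · rw [act_of_fixed hx h'.1 h'.2]
      simpa using h
    · rw [act_of_lt hx h (by tauto)]
      simpa using simpleRefl_lt h h'
  · rwa [act_of_gt hx h]

theorem down_act {x : Perm (Fin n)} (hx : x⁻¹ = x) {i : Fin (n - 1)} (h : x (lo i) < x (hi i)) :
    down (act x i) i = x := by
  by_cases h' : x (lo i) = lo i ∧ x (hi i) = hi i
  · rw [act_of_fixed hx h'.1 h'.2, down, if_pos (by simp [h'.2]), mul_assoc, simpleRefl_mul_self,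
      mul_one]
  · rw [act_of_lt hx h (by tauto), down, if_neg]
    · simp only [mul_assoc, simpleRefl_mul_self, mul_one]
      rw [← mul_assoc, simpleRefl_mul_self, one_mul]
    · intro e
      simp only [Perm.mul_apply, simpleRefl_lo] at e
      have e' := congrArg (simpleRefl i) e
      rw [simpleRefl_simpleRefl, simpleRefl_hi] at e'
      rw [(apply_eq_iff_of_inv_eq hx).1 e', e'] at h
      exact lt_asymm h (lo_lt_hi i)

/-! ### Rank and reduced words. -/

/-- Four times the length of the involution words of an involution. -/
def rank (x : Perm (Fin n)) : ℕ := 2 * (inversions x).card + x.support.card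

/-- Multiplying by a disjoint `s_i` adds one inversion and two moved points; conjugating adds two
inversions and keeps the size of the support. Both give 4. -/
theorem rank_act {x : Perm (Fin n)} (hx : x⁻¹ = x) {i : Fin (n - 1)} (h : x (lo i) < x (hi i)) :
    rank (act x i) = rank x + 4 := by
  unfold rank
  by_cases h' : x (lo i) = lo i ∧ x (hi i) = hi i
  · rw [act_of_fixed hx h'.1 h'.2, card_inversions_mul_simpleRefl h, Perm.Disjoint.card_support_mul,
      simpleRefl_eq, Perm.card_support_swap (lo_ne_hi i)]
    · ring
    · intro p
      by_cases hp : p = lo i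
      · exact Or.inl (hp ▸ h'.1)
      · by_cases hp' : p = hi i
        · exact Or.inl (hp' ▸ h'.2)
        · exact Or.inr (simpleRefl_of_ne hp hp')
  · have e : (inversions (simpleRefl i * x)).card = (inversions x).card + 1 := by
      rw [← card_inversions_inv, mul_inv_rev, hx, simpleRefl_inv, card_inversions_mul_simpleRefl h]
    have e₂ : (inversions (simpleRefl i * x * simpleRefl i)).card =
        (inversions (simpleRefl i * x)).card + 1 :=
      card_inversions_mul_simpleRefl (simpleRefl_lt h h')
    have e' := Perm.card_support_conj (σ := simpleRefl i) (τ := x)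
    rw [simpleRefl_inv] at e'
    rw [act_of_lt hx h (by tauto), e₂, e, e']
    ring

theorem rank_act_le {x : Perm (Fin n)} (hx : x⁻¹ = x) (i : Fin (n - 1)) :
    rank (act x i) ≤ rank x + 4 := by
  rcases lt_or_gt_of_ne (apply_lo_ne_apply_hi x i) with h | h
  · exact (rank_act hx h).le
  · rw [act_of_gt hx h]
    omega

theorem rank_one : rank (1 : Perm (Fin n)) = 0 := by simp [rank, inversions_one]

theorem actWord_append (x : Perm (Fin n)) (a b : Word n) :
    actWord x (a ++ b) = actWord (actWord x a) b :=
  List.foldl_append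

theorem actWord_one_inv (a : Word n) : (actWord 1 a)⁻¹ = actWord 1 a := by
  induction a using List.reverseRecOn with
  | nil => simp [actWord]
  | append_singleton a i ih =>
    rw [actWord_append]
    exact act_inv ih i

theorem rank_actWord_one_le (a : Word n) : rank (actWord 1 a) ≤ 4 * a.length := by
  induction a using List.reverseRecOn with
  | nil => simp [actWord, rank_one]
  | append_singleton a i ih =>
    have := rank_act_le (actWord_one_inv a) i
    rw [actWord_append, List.length_append, List.length_singleton]
    change rank (act (actWord 1 a) i) ≤ _
    omega

/-- `a` leads from the identity to `x`, and each of its letters raises the rank. -/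
def IsReduced (x : Perm (Fin n)) (a : Word n) : Prop :=
  actWord 1 a = x ∧ 4 * a.length = rank x

theorem IsReduced.append {y : Perm (Fin n)} {a : Word n} (h : IsReduced y a) {i : Fin (n - 1)}
    (hi' : y (lo i) < y (hi i)) : IsReduced (act y i) (a ++ [i]) := by
  have hy : y⁻¹ = y := h.1 ▸ actWord_one_inv a
  refine ⟨by rw [actWord_append, h.1]; rfl, ?_⟩
  rw [rank_act hy hi', ← h.2, List.length_append, List.length_singleton]
  ring

theorem IsReduced.append_down {x : Perm (Fin n)} (hx : x⁻¹ = x) {a : Word n} {i : Fin (n - 1)}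
    (hi' : x (hi i) < x (lo i)) (h : IsReduced (down x i) a) : IsReduced x (a ++ [i]) := by
  have := h.append (down_lt hi')
  rwa [act_down hx hi'] at this

theorem IsReduced.of_append {x : Perm (Fin n)} {a : Word n} {i : Fin (n - 1)}
    (h : IsReduced x (a ++ [i])) : x (hi i) < x (lo i) ∧ IsReduced (down x i) a := by
  obtain ⟨h₁, h₂⟩ := h
  have ha := actWord_one_inv a
  have hr := rank_actWord_one_le a
  rw [actWord_append] at h₁
  change act (actWord 1 a) i = x at h₁
  rw [List.length_append, List.length_singleton] at h₂
  subst h₁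
  rcases lt_or_gt_of_ne (apply_lo_ne_apply_hi (actWord 1 a) i) with h | h
  · rw [rank_act ha h] at h₂
    refine ⟨act_gt ha i, ?_⟩
    rw [down_act ha h]
    exact ⟨rfl, by omega⟩
  -- A last letter that does nothing would leave rank `4 * (a.length + 1)` to a word of length
  -- `a.length`.
  · rw [act_of_gt ha h] at h₂
    omega

theorem rank_down {x : Perm (Fin n)} (hx : x⁻¹ = x) {i : Fin (n - 1)} (h : x (hi i) < x (lo i)) :
    rank (down x i) + 4 = rank x := by
  rw [← rank_act (down_inv hx i) (down_lt h), act_down hx h]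

theorem exists_isReduced {x : Perm (Fin n)} (hx : x⁻¹ = x) : ∃ a, IsReduced x a := by
  induction hk : rank x using Nat.strong_induction_on generalizing x with
  | _ k ih =>
    subst hk
    by_cases h : x = 1
    · exact ⟨[], by simp [actWord, h], by simp [h, rank_one]⟩
    · obtain ⟨i, h'⟩ := exists_gt_of_ne_one h
      have hr := rank_down hx h'
      obtain ⟨a, ha⟩ := ih _ (by omega) (down_inv hx i) rfl
      exact ⟨a ++ [i], ha.append_down hx h'⟩

/-- A letter raises the rank by at most 4, and descending from `x` to 1 yields a word attaining this
bound. Minimality thus becomes an equation on lengths. -/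
theorem mem_involutionWords {x : Perm (Fin n)} (hx : x⁻¹ = x) {a : Word n} :
    a ∈ involutionWords x ↔ IsReduced x a := by
  constructor
  · rintro ⟨h₁, h₂⟩
    obtain ⟨b, hb⟩ := exists_isReduced hx
    refine ⟨h₁, ?_⟩
    have h₃ := h₂ b hb.1
    have h₄ := rank_actWord_one_le a
    rw [h₁] at h₄
    have := hb.2
    omega
  · rintro ⟨h₁, h₂⟩
    refine ⟨h₁, fun b hb => ?_⟩
    change actWord 1 b = x at hb
    have h₄ := rank_actWord_one_le b
    rw [hb] at h₄
    omega

/-! ### Equivalence of words and its invariants. -/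

/-- The equivalence of words under braid relations and initial relations. -/
def Equivalent (a b : Word n) : Prop := involutionBraidSetoid n a b

theorem Equivalent.symm {a b : Word n} (h : Equivalent a b) : Equivalent b a :=
  Relation.EqvGen.symm _ _ h

theorem Equivalent.trans {a b c : Word n} (h : Equivalent a b) (h' : Equivalent b c) :
    Equivalent a c :=
  Relation.EqvGen.trans _ _ _ h h'

/-- Initial relations survive extension on the right but not in general on the left; this is why the
induction removes last letters. -/
theorem Equivalent.append {a b : Word n} (h : Equivalent a b) (c : Word n) :
    Equivalent (a ++ c) (b ++ c) := by
  induction h with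
  | rel a b h =>
    apply Relation.EqvGen.rel
    rcases h with h | h
    · left
      rcases h with ⟨a, b, i, j, h⟩ | ⟨a, b, i, j, h⟩
      · simpa using BraidRel.braid a (b ++ c) i j h
      · simpa using BraidRel.comm a (b ++ c) i j h
    · right
      rcases h with ⟨b, i, j, h⟩
      exact InitialRel.swap (b ++ c) i j h
  | refl a => exact Relation.EqvGen.refl _
  | symm a b _ ih => exact ih.symm
  | trans a b c _ _ ih ih' => exact ih.trans ih'

/-- Both sides are conjugates of one simple transposition by the other, equal by the braid relation.
-/
theorem act_act_one {i j : Fin (n - 1)} (h : i.val + 1 = j.val) :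
    act (act 1 i) j = act (act 1 j) i := by
  have h₁ : hi i ≠ hi j := by simp only [ne_eq, Fin.ext_iff, hi_val]; omega
  have h₂ : lo i ≠ hi j := by simp only [ne_eq, Fin.ext_iff, lo_val, hi_val]; omega
  have h₃ : lo i < hi j := by simp only [Fin.lt_def, lo_val, hi_val]; omega
  have e₁ : simpleRefl i (hi j) = hi j := simpleRefl_of_ne h₂.symm h₁.symm
  have e₂ : simpleRefl j (lo i) = lo i :=
    simpleRefl_of_ne (by rw [lo_eq_hi h]; exact lo_ne_hi i) h₂
  have e₃ : simpleRefl i (lo j) = lo i := by rw [lo_eq_hi h, simpleRefl_hi]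
  have e₄ : simpleRefl j (hi i) = hi j := by rw [← lo_eq_hi h, simpleRefl_lo]
  rw [act_of_fixed inv_one rfl rfl, act_of_fixed inv_one rfl rfl, one_mul, one_mul,
    act_of_lt (simpleRefl_inv i), act_of_lt (simpleRefl_inv j), simpleRefl_braid h]
  · rwa [e₂, e₄]
  · exact Or.inr (by rw [e₄]; exact h₁.symm)
  · rwa [e₁, e₃]
  · exact Or.inl (by rw [e₃, lo_eq_hi h]; exact lo_ne_hi i)

theorem Equivalent.actWord_one_eq {a b : Word n} (h : Equivalent a b) :
    actWord 1 a = actWord 1 b ∧ a.length = b.length := by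
  induction h with
  | rel a b h =>
    rcases h with h | h
    · rcases h with ⟨a, b, i, j, h⟩ | ⟨a, b, i, j, h⟩
      · refine ⟨?_, by simp⟩
        rw [actWord_append, actWord_append, actWord_append, actWord_append]
        exact congrArg (actWord · b) (act_braid h _)
      · refine ⟨?_, by simp⟩
        rw [actWord_append, actWord_append, actWord_append, actWord_append]
        exact congrArg (actWord · b) (act_comm h _)
    · rcases h with ⟨b, i, j, h⟩
      exact ⟨congrArg (actWord · b) (act_act_one h), rfl⟩
  | refl a => exact ⟨rfl, rfl⟩
  | symm a b _ ih => exact ⟨ih.1.symm, ih.2.symm⟩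
  | trans a b c _ _ ih ih' => exact ⟨ih.1.trans ih'.1, ih.2.trans ih'.2⟩

theorem IsReduced.of_equivalent {x : Perm (Fin n)} {a b : Word n} (ha : IsReduced x a)
    (h : Equivalent a b) : IsReduced x b := by
  obtain ⟨h₁, h₂⟩ := h.actWord_one_eq
  exact ⟨h₁ ▸ ha.1, h₂ ▸ ha.2⟩

/-! ### Linking two descents of an involution. -/

/-- Some involution word of `x` ending in `i` is equivalent to one ending in `j`. -/
def Linked (x : Perm (Fin n)) (i j : Fin (n - 1)) : Prop :=
  ∃ a b, IsReduced x (a ++ [i]) ∧ IsReduced x (b ++ [j]) ∧ Equivalent (a ++ [i]) (b ++ [j])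

theorem Linked.symm {x : Perm (Fin n)} {i j : Fin (n - 1)} (h : Linked x i j) : Linked x j i := by
  obtain ⟨a, b, ha, hb, h⟩ := h
  exact ⟨b, a, hb, ha, h.symm⟩

theorem down_apply_lt {x : Perm (Fin n)} {i : Fin (n - 1)} {p q : Fin n}
    (h : x (simpleRefl i p) < x (simpleRefl i q))
    (h' : ¬(x (simpleRefl i p) = lo i ∧ x (simpleRefl i q) = hi i)) :
    down x i p < down x i q := by
  unfold down
  split_ifs
  · exact h
  · exact simpleRefl_lt h h'

/-- The excluded configuration is the one in which conjugation by `s_i` destroys the descent `j`.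
Otherwise one can descend by `i`, then `j`, and commute the last two letters. -/
theorem linked_of_comm {x : Perm (Fin n)} (hx : x⁻¹ = x) {i j : Fin (n - 1)}
    (hij : i.val + 1 < j.val) (h₁ : x (hi i) < x (lo i)) (h₂ : x (hi j) < x (lo j))
    (h : ¬(x (lo i) = hi j ∧ x (hi i) = lo j)) : Linked x i j := by
  have e₁ : simpleRefl i (lo j) = lo j := by
    apply simpleRefl_of_ne <;> simp only [ne_eq, Fin.ext_iff, lo_val, hi_val] <;> omega
  have e₂ : simpleRefl i (hi j) = hi j := by
    apply simpleRefl_of_ne <;> simp only [ne_eq, Fin.ext_iff, lo_val, hi_val] <;> omega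
  have h₃ : down x i (hi j) < down x i (lo j) := by
    apply down_apply_lt
    · rwa [e₁, e₂]
    · rw [e₁, e₂, apply_eq_iff_of_inv_eq hx, apply_eq_iff_of_inv_eq hx (p := lo j)]
      exact h
  have hy := down_inv hx i
  obtain ⟨c, hc⟩ := exists_isReduced (down_inv hy j)
  have ha := (hc.append_down hy h₃).append_down hx h₁
  have e : Equivalent (c ++ [j] ++ [i]) (c ++ [i] ++ [j]) :=
    Relation.EqvGen.rel _ _ (Or.inl (by simpa using BraidRel.comm c [] j i (Or.inr hij)))
  exact ⟨_, _, ha, ha.of_equivalent e, e⟩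

/-- Here `x` decreases on the three points `lo i`, `hi i`, `hi j`. If `x` does not send the first to
the last, one can descend by `i`, `j`, `i` and braid the last three letters. -/
theorem linked_of_braid {x : Perm (Fin n)} (hx : x⁻¹ = x) {i j : Fin (n - 1)}
    (hij : i.val + 1 = j.val) (h₁ : x (hi i) < x (lo i)) (h₂ : x (hi j) < x (lo j))
    (h : x (lo i) ≠ hi j) : Linked x i j := by
  have n₁ : hi i ≠ hi j := by simp only [ne_eq, Fin.ext_iff, hi_val]; omega
  have n₂ : lo i ≠ hi j := by simp only [ne_eq, Fin.ext_iff, lo_val, hi_val]; omega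
  have n₃ := lo_ne_hi i
  have e₁ : simpleRefl i (hi j) = hi j := simpleRefl_of_ne n₂.symm n₁.symm
  have e₂ : simpleRefl j (lo i) = lo i := simpleRefl_of_ne (by rwa [lo_eq_hi hij]) n₂
  have e₄ : simpleRefl j (hi i) = hi j := by rw [← lo_eq_hi hij, simpleRefl_lo]
  rw [lo_eq_hi hij] at h₂
  have hy := down_inv hx i
  have hz := down_inv hy j
  have h₃ : down x i (hi j) < down x i (hi i) := by
    apply down_apply_lt
    · rw [e₁, simpleRefl_hi]
      exact h₂.trans h₁
    · rw [e₁, simpleRefl_hi]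
      exact fun h' => h ((apply_eq_iff_of_inv_eq hx).1 h'.1)
  have h₄ : down x i (hi j) < down x i (lo i) := by
    apply down_apply_lt
    · rwa [e₁, simpleRefl_lo]
    · rw [e₁, simpleRefl_lo]
      exact fun h' => h ((apply_eq_iff_of_inv_eq hx).1 h'.1)
  have h₅ : down (down x i) j (hi i) < down (down x i) j (lo i) := by
    apply down_apply_lt
    · rwa [e₂, e₄]
    · rw [e₂, e₄, lo_eq_hi hij]
      intro h'
      have := (apply_eq_iff_of_inv_eq hy).1 h'.1
      exact n₃ ((down x i).injective (h'.2.trans this.symm))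
  obtain ⟨c, hc⟩ := exists_isReduced (down_inv hz i)
  have ha := ((hc.append_down hz h₅).append_down hy (by rwa [lo_eq_hi hij])).append_down hx h₁
  have e : Equivalent (c ++ [i] ++ [j] ++ [i]) (c ++ [j] ++ [i] ++ [j]) :=
    Relation.EqvGen.rel _ _ (Or.inl (by simpa using BraidRel.braid c [] i j hij))
  exact ⟨_, _, ha, ha.of_equivalent e, e⟩

/-- The result fixes the three points `lo i`, `hi i`, `hi j` and agrees with `x` elsewhere. It has
no descents, hence is the identity. -/
theorem down_down_eq_one {x : Perm (Fin n)} (hx : x⁻¹ = x) {i j : Fin (n - 1)}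
    (hij : i.val + 1 = j.val) (hl : x (lo i) = hi j) (hm : x (hi i) = hi i)
    (h : ∀ r, r ≠ i → r ≠ j → x (lo r) < x (hi r)) : down (down x i) j = 1 := by
  have n₁ : hi i ≠ hi j := by simp only [ne_eq, Fin.ext_iff, hi_val]; omega
  have n₂ : lo i ≠ hi j := by simp only [ne_eq, Fin.ext_iff, lo_val, hi_val]; omega
  have n₃ := lo_ne_hi i
  have hr := (apply_eq_iff_of_inv_eq hx).1 hl
  have e₁ : simpleRefl i (hi j) = hi j := simpleRefl_of_ne n₂.symm n₁.symm
  have e₂ : simpleRefl j (lo i) = lo i := simpleRefl_of_ne (by rwa [lo_eq_hi hij]) n₂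
  have e₃ : simpleRefl j (hi j) = hi i := by rw [← lo_eq_hi hij, simpleRefl_hi]
  have e₄ : simpleRefl j (hi i) = hi j := by rw [← lo_eq_hi hij, simpleRefl_lo]
  have ez : down (down x i) j = simpleRefl i * x * simpleRefl i * simpleRefl j := by
    have : down x i = simpleRefl i * x * simpleRefl i := if_neg (by rw [hl]; exact n₁.symm)
    rw [this, down, if_pos]
    simp [lo_eq_hi hij, hl, e₁]
  have zl : down (down x i) j (lo i) = lo i := by simp [ez, e₂, hm]
  have zm : down (down x i) j (hi i) = hi i := by simp [ez, e₄, e₁, hr]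
  have zr : down (down x i) j (hi j) = hi j := by simp [ez, e₃, e₁, hl]
  have hne : ∀ p, p ≠ lo i → p ≠ hi i → p ≠ hi j →
      x p ≠ lo i ∧ x p ≠ hi i ∧ x p ≠ hi j := fun p h₁ h₂ h₃ =>
    ⟨fun e => h₃ (x.injective (e.trans hr.symm)), fun e => h₂ (x.injective (e.trans hm.symm)),
      fun e => h₁ (x.injective (e.trans hl.symm))⟩
  have zp : ∀ p, p ≠ lo i → p ≠ hi i → p ≠ hi j → down (down x i) j p = x p := by
    intro p h₁ h₂ h₃
    obtain ⟨h₄, h₅, -⟩ := hne p h₁ h₂ h₃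
    rw [ez, Perm.mul_apply, Perm.mul_apply, Perm.mul_apply,
      simpleRefl_of_ne (by rwa [lo_eq_hi hij]) h₃, simpleRefl_of_ne h₁ h₂, simpleRefl_of_ne h₄ h₅]
  refine eq_one_of_forall_lt fun r => ?_
  by_cases hri : r = i
  · rw [hri, zl, zm]
    exact lo_lt_hi i
  by_cases hrj : r = j
  · rw [hrj, lo_eq_hi hij, zm, zr, ← lo_eq_hi hij]
    exact lo_lt_hi j
  have hlt := h r hri hrj
  have hri' : r.val ≠ i.val := fun e => hri (Fin.ext e)
  have hrj' : r.val ≠ j.val := fun e => hrj (Fin.ext e)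
  -- Next to the block, the ascent of `x` gives only `x (lo r) < hi j`; since `x (lo r)` avoids the
  -- three points of the block, it lies below `lo i`. The right end is symmetric.
  by_cases h₁ : r.val + 1 = i.val
  · rw [← lo_eq_hi h₁, zl, zp] <;>
      try (simp only [ne_eq, Fin.ext_iff, lo_val, hi_val]; omega)
    rw [← lo_eq_hi h₁, hl] at hlt
    have := hne (lo r) (by simp only [ne_eq, Fin.ext_iff, lo_val]; omega)
      (by simp only [ne_eq, Fin.ext_iff, lo_val, hi_val]; omega)
      (by simp only [ne_eq, Fin.ext_iff, lo_val, hi_val]; omega)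
    simp only [ne_eq, Fin.ext_iff, Fin.lt_def, lo_val, hi_val] at this hlt ⊢
    omega
  by_cases h₂ : j.val + 1 = r.val
  · rw [lo_eq_hi h₂, zr, zp] <;>
      try (simp only [ne_eq, Fin.ext_iff, lo_val, hi_val]; omega)
    rw [lo_eq_hi h₂, hr] at hlt
    have := hne (hi r) (by simp only [ne_eq, Fin.ext_iff, lo_val, hi_val]; omega)
      (by simp only [ne_eq, Fin.ext_iff, hi_val]; omega)
      (by simp only [ne_eq, Fin.ext_iff, hi_val]; omega)
    simp only [ne_eq, Fin.ext_iff, Fin.lt_def, lo_val, hi_val] at this hlt ⊢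
    omega
  rw [zp, zp]
  · exact hlt
  all_goals simp only [ne_eq, Fin.ext_iff, lo_val, hi_val]; omega

/-- The value at the middle point lies strictly between `lo i` and `hi j`, which leaves only the
middle point. -/
theorem apply_hi_eq_of_reversed {x : Perm (Fin n)} (hx : x⁻¹ = x) {i j : Fin (n - 1)}
    (hij : i.val + 1 = j.val) (h₁ : x (hi i) < x (lo i)) (h₂ : x (hi j) < x (lo j))
    (hl : x (lo i) = hi j) : x (hi i) = hi i := by
  rw [lo_eq_hi hij, (apply_eq_iff_of_inv_eq hx).1 hl] at h₂
  rw [hl] at h₁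
  simp only [Fin.lt_def, Fin.ext_iff, lo_val, hi_val] at *
  omega

theorem linked_of_initial {x : Perm (Fin n)} (hx : x⁻¹ = x) {i j : Fin (n - 1)}
    (hij : i.val + 1 = j.val) (h₁ : x (hi i) < x (lo i)) (h₂ : x (hi j) < x (lo j))
    (hl : x (lo i) = hi j) (h : ∀ r, r ≠ i → r ≠ j → x (lo r) < x (hi r)) : Linked x i j := by
  have e := down_down_eq_one hx hij hl (apply_hi_eq_of_reversed hx hij h₁ h₂ hl) h
  have hy := down_inv hx i
  have h₃ : down x i (hi j) < down x i (lo j) := by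
    -- In fact `down x i` interchanges `lo j` and `hi j`.
    by_contra h₃
    have h₄ := lt_of_le_of_ne (not_lt.1 h₃) (apply_lo_ne_apply_hi _ _)
    have n₁ : hi i ≠ hi j := by simp only [ne_eq, Fin.ext_iff, hi_val]; omega
    have : down x i (lo j) = hi j := by
      rw [down, if_neg (by rw [hl]; exact n₁.symm), Perm.mul_apply, Perm.mul_apply, lo_eq_hi hij,
        simpleRefl_hi, hl, simpleRefl_of_ne _ n₁.symm]
      simp only [ne_eq, Fin.ext_iff, lo_val, hi_val]
      omega
    rw [(apply_eq_iff_of_inv_eq hy).1 this, this] at h₄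
    exact lt_asymm h₄ (lo_lt_hi j)
  have h₀ : IsReduced (down (down x i) j) [] := ⟨by rw [e]; rfl, by rw [e, rank_one]; rfl⟩
  have ha := (h₀.append_down hy h₃).append_down hx h₁
  have e : Equivalent ([j] ++ [i]) ([i] ++ [j]) :=
    Relation.EqvGen.symm _ _ (Relation.EqvGen.rel _ _ (Or.inr (InitialRel.swap [] i j hij)))
  exact ⟨_, _, ha, ha.of_equivalent e, e⟩

theorem apply_le_of_forall_lt {x : Perm (Fin n)} {p q : Fin n} (hpq : p ≤ q)
    (h : ∀ r : Fin (n - 1), p.val ≤ r.val → r.val < q.val → x (lo r) < x (hi r)) : x p ≤ x q := by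
  obtain ⟨q, hq⟩ := q
  induction q with
  | zero => exact (congrArg x (Fin.ext (Nat.le_zero.1 hpq))).le
  | succ q ih =>
    rcases Nat.lt_or_ge q p.val with h' | h'
    · refine (congrArg x (Fin.ext ?_)).le
      simp only [Fin.le_def] at hpq ⊢
      omega
    · have h₁ := ih (by omega) h' fun r hr hr' => h r hr (Nat.lt_succ_of_lt hr')
      exact h₁.trans (h ⟨q, by omega⟩ h' (Nat.lt_succ_self q)).le

/-- The involution interchanges `hi i < lo j`, so it cannot increase all the way between them. -/
theorem exists_gt_between {x : Perm (Fin n)} (hx : x⁻¹ = x) {i j : Fin (n - 1)}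
    (hij : i.val + 1 < j.val) (hm : x (hi i) = lo j) :
    ∃ r : Fin (n - 1), i.val < r.val ∧ r.val < j.val ∧ x (hi r) < x (lo r) := by
  by_contra! h
  have := apply_le_of_forall_lt (x := x) (p := hi i) (q := lo j) hij.le fun r hr hr' =>
    lt_of_le_of_ne (h r hr hr') (apply_lo_ne_apply_hi x r)
  rw [(apply_eq_iff_of_inv_eq hx).1 hm, hm] at this
  simp only [Fin.le_def, lo_val, hi_val] at this
  omega

/-- Distinct descents of an involution are linked directly or through a third descent. -/
theorem linked_or_exists {x : Perm (Fin n)} (hx : x⁻¹ = x) {i j : Fin (n - 1)}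
    (hij : i.val < j.val) (h₁ : x (hi i) < x (lo i)) (h₂ : x (hi j) < x (lo j)) :
    Linked x i j ∨ ∃ r, x (hi r) < x (lo r) ∧ Linked x i r ∧ Linked x r j := by
  -- The only obstruction to a direct link is `x (lo i) = hi j`. As `x` is injective, a third
  -- descent escapes it with respect to both `i` and `j`.
  have key : ∀ i j : Fin (n - 1), i.val < j.val → x (hi i) < x (lo i) → x (hi j) < x (lo j) →
      x (lo i) ≠ hi j → Linked x i j := by
    intro i j hij h₁ h₂ h
    rcases Nat.lt_or_ge (i.val + 1) j.val with h' | h'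
    · exact linked_of_comm hx h' h₁ h₂ fun h'' => h h''.1
    · exact linked_of_braid hx (by omega) h₁ h₂ h
  by_cases hl : x (lo i) = hi j
  swap
  · exact Or.inl (key i j hij h₁ h₂ hl)
  have hi_inj : ∀ r s : Fin (n - 1), hi r = hi s → r.val = s.val := fun r s h => by
    simpa [Fin.ext_iff] using h
  have lo_inj : ∀ r s : Fin (n - 1), x (lo r) = x (lo s) → r.val = s.val := fun r s h => by
    simpa [Fin.ext_iff] using x.injective h
  rcases Nat.lt_or_ge (i.val + 1) j.val with h' | h'
  · by_cases hm : x (hi i) = lo j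
    · obtain ⟨r, hir, hrj, hr⟩ := exists_gt_between hx h' hm
      refine Or.inr ⟨r, hr, key i r hir h₁ hr fun e => ?_, key r j hrj hr h₂ fun e => ?_⟩
      · exact hrj.ne' (hi_inj _ _ (hl.symm.trans e))
      · exact hir.ne' (lo_inj _ _ (e.trans hl.symm))
    · exact Or.inl (linked_of_comm hx h' h₁ h₂ fun e => hm e.2)
  have hij' : i.val + 1 = j.val := by omega
  by_cases h : ∀ r, r ≠ i → r ≠ j → x (lo r) < x (hi r)
  · exact Or.inl (linked_of_initial hx hij' h₁ h₂ hl h)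
  push Not at h
  obtain ⟨r, hri, hrj, hr⟩ := h
  replace hr := lt_of_le_of_ne hr (apply_lo_ne_apply_hi x r).symm
  replace hri : r.val ≠ i.val := fun e => hri (Fin.ext e)
  replace hrj : r.val ≠ j.val := fun e => hrj (Fin.ext e)
  have hm := apply_hi_eq_of_reversed hx hij' h₁ h₂ hl
  refine Or.inr ⟨r, hr, ?_⟩
  rcases Nat.lt_or_ge r.val i.val with hlt | hge
  · refine ⟨(key r i hlt hr h₁ fun e => ?_).symm, key r j (by omega) hr h₂ fun e => ?_⟩
    · have := congrArg Fin.val (x.injective (e.trans hm.symm))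
      simp only [lo_val, hi_val] at this
      omega
    · exact hri (lo_inj _ _ (e.trans hl.symm))
  · refine ⟨key i r (by omega) h₁ hr fun e => ?_, (key j r (by omega) h₂ hr fun e => ?_).symm⟩
    · exact hrj (hi_inj _ _ (e.symm.trans hl))
    · rw [lo_eq_hi hij', hm] at e
      exact hri (hi_inj _ _ e).symm

/-! ### Connectedness by induction on the rank. -/

theorem equivalent_of_isReduced {x : Perm (Fin n)} (hx : x⁻¹ = x) {a b : Word n}
    (ha : IsReduced x a) (hb : IsReduced x b) : Equivalent a b := by
  induction hk : rank x using Nat.strong_induction_on generalizing x a b with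
  | _ k ih =>
    subst hk
    have same : ∀ (i : Fin (n - 1)) (a b : Word n), IsReduced x (a ++ [i]) →
        IsReduced x (b ++ [i]) → Equivalent (a ++ [i]) (b ++ [i]) := by
      intro i a b ha hb
      obtain ⟨h, ha⟩ := ha.of_append
      have := rank_down hx h
      exact (ih _ (by omega) (down_inv hx i) ha hb.of_append.2 rfl).append [i]
    -- One linked pair suffices: `same` joins any two reduced words of `x` with a common last
    -- letter.
    have linked : ∀ (i j : Fin (n - 1)) (a b : Word n), Linked x i j → IsReduced x (a ++ [i]) →
        IsReduced x (b ++ [j]) → Equivalent (a ++ [i]) (b ++ [j]) := by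
      rintro i j a b ⟨a', b', ha', hb', h⟩ ha hb
      exact ((same i a a' ha ha').trans h).trans (same j b' b hb' hb)
    have lt : ∀ (i j : Fin (n - 1)) (a b : Word n), i.val < j.val → IsReduced x (a ++ [i]) →
        IsReduced x (b ++ [j]) → Equivalent (a ++ [i]) (b ++ [j]) := by
      intro i j a b hij ha hb
      rcases linked_or_exists hx hij ha.of_append.1 hb.of_append.1 with h | ⟨r, hr, h, h'⟩
      · exact linked i j a b h ha hb
      · obtain ⟨c, hc⟩ := exists_isReduced (down_inv hx r)
        have hc := hc.append_down hx hr
        exact (linked i r a c h ha hc).trans (linked r j c b h' hc hb)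
    rcases a.eq_nil_or_concat with rfl | ⟨a, i, rfl⟩
    · have h := ha.2.trans hb.2.symm
      have : b = [] := List.eq_nil_of_length_eq_zero (by simpa using h.symm)
      exact this ▸ Relation.EqvGen.refl _
    rcases b.eq_nil_or_concat with rfl | ⟨b, j, rfl⟩
    · have h := ha.2.trans hb.2.symm
      simp at h
    rw [List.concat_eq_append] at ha hb ⊢
    rw [List.concat_eq_append]
    rcases lt_trichotomy i.val j.val with h | h | h
    · exact lt i j a b h ha hb
    · obtain rfl := Fin.ext h
      exact same i a b ha hb
    · exact (lt j i b a h hb ha).symm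

end InvWords

theorem theorem7p1 (n : ℕ) (x : Equiv.Perm (Fin n)) (hx : x⁻¹ = x) :
    InvWords.involutionWords x ∈ (InvWords.involutionBraidSetoid n).classes := by
  obtain ⟨a, ha⟩ := InvWords.exists_isReduced hx
  refine ⟨a, Set.ext fun b => ?_⟩
  rw [InvWords.mem_involutionWords hx]
  exact ⟨fun hb => InvWords.equivalent_of_isReduced hx hb ha,
    fun hb => ha.of_equivalent (InvWords.Equivalent.symm hb)⟩
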